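/- All graphs are finite and simple. For a graph $G$ and $X\subseteq V(G)$, let $\rho_G(X)$ be the rank over $\mathrm{GF}(2)$ of the submatrix of the adjacency matrix of $G$ with rows indexed by $X$ and columns indexed by $V(G)\setminus X$, and for disjoint $S,T\subseteq V(G)$ let $\kappa_G(S,T)=\min\{\rho_G(X): S\subseteq X\subseteq V(G)\setminus T\}$. For a vertex $v$, let $G\setminus v$ be the graph obtained by deleting $v$, and let $G*v$ be the graph obtained from $G$ by replacing the subgraph induced on the set of neighbors of $v$ with its complement. For an edge $uv$, let $G\wedge uv=G*u*v*u$. Proposition. Let $G$ be a graph and let $Q,R,S,T\subseteq V(G)$ with $Q\cap R=S\cap T=\emptyset$. Let $F=V(G)\setminus(Q\cup R\cup S\cup T)$, $k=\kappa_G(Q,R)$ and $\ell=\kappa_G(S,T)$. If $|S|=|T|=\ell$ and $|F|\ge(2\ell+1)2^{2k}$, then there is a vertex $v\in F$ such that at least two of the following hold: (1) $\kappa_{G\setminus v}(Q,R)=k$ and $\kappa_{G\setminus v}(S,T)=\ell$. (2) $\kappa_{G*v\setminus v}(Q,R)=k$ and $\kappa_{G*v\setminus v}(S,T)=\ell$.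 (3) $\kappa_{G\wedge uv\setminus v}(Q,R)=k$ and $\kappa_{G\wedge uv\setminus v}(S,T)=\ell$ for every neighbor $u$ of $v$. -/

import Mathlib

namespace SimpleGraph

/-- The local complementation `G * v`: adjacency is flipped between every pair of distinct
neighbours of `v`, and is unchanged on all other pairs. -/
def localComplement {V : Type*} (G : SimpleGraph V) (v : V) : SimpleGraph V where
  Adj x y := x ≠ y ∧ Xor (G.Adj x y) (G.Adj v x ∧ G.Adj v y)
  symm := ⟨fun x y h => ⟨h.1.symm, by
    rw [G.adj_comm y x, and_comm (a := G.Adj v y)]; exact h.2⟩⟩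
  loopless := ⟨fun _ h => h.1 rfl⟩

/-- Pivoting: `G ∧ uv = G * u * v * u` (used only when `uv` is an edge of `G`). -/
def pivot {V : Type*} (G : SimpleGraph V) (u v : V) : SimpleGraph V :=
  ((G.localComplement u).localComplement v).localComplement u

/-- Vertex deletion `G \ v`, a graph whose vertices are the vertices of `G` other than `v`. -/
def deleteVertex {V : Type*} (G : SimpleGraph V) (v : V) : SimpleGraph {w : V // w ≠ v} :=
  G.comap Subtype.val

open Classical in
/-- The cut-rank `ρ_G(X)`: the rank over `GF(2)` of the submatrix of the adjacency matrix of `G`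
with rows indexed by `X` and columns indexed by `V(G) - X`. -/
noncomputable def cutRank {V : Type*} [Finite V] (G : SimpleGraph V) (X : Set V) : ℕ :=
  letI : Fintype {x : V // x ∉ X} := Fintype.ofFinite _
  ((G.adjMatrix (ZMod 2)).submatrix
    (Subtype.val : {x : V // x ∈ X} → V) (Subtype.val : {x : V // x ∉ X} → V)).rank

/-- The connectivity `κ_G(S, T)` of disjoint sets `S` and `T`: the minimum of `ρ_G(X)` over all
`X` with `S ⊆ X ⊆ V(G) - T`. -/
noncomputable def cutConnectivity {V : Type*} [Finite V] (G : SimpleGraph V) (S T : Set V) : ℕ :=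
  sInf {r : ℕ | ∃ X : Set V, S ⊆ X ∧ X ⊆ Tᶜ ∧ G.cutRank X = r}

/-- For a graph `H` whose vertices are the elements of `V` other than `v`, the statement that
`κ_H(Q, R) = k` and `κ_H(S, T) = l`, for sets `Q, R, S, T` that do not contain `v`. -/
def HasConnectivities {V : Type*} [Finite V] {v : V} (H : SimpleGraph {w : V // w ≠ v})
    (Q R S T : Set V) (k l : ℕ) : Prop :=
  H.cutConnectivity (Subtype.val ⁻¹' Q) (Subtype.val ⁻¹' R) = k ∧
    H.cutConnectivity (Subtype.val ⁻¹' S) (Subtype.val ⁻¹' T) = l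

end SimpleGraph

/-- At least two of the three propositions hold. -/
def AtLeastTwo (a b c : Prop) : Prop :=
  (a ∧ b) ∨ (a ∧ c) ∨ (b ∧ c)

/-! Attach to a vector `u` the pair (`u v`, `G.nbrSum u v`) at each vertex `v`. The vectors whose
pairs vanish outside X form `cutSpace X`, of dimension |X| - ρ(X). The three ways of removing `v`
correspond to the three nonzero functionals on the pair; a nonzero pair is killed by exactly one of
them, the type of `u` at `v`.

A submodularity count shows that at most one way of removing `v` lowers a given connectivity
(`LowersConnectivity.eq`). If the theorem fails, every `v` in F thus has a way a(v) lowering κ(Q,R),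
a different way b(v) lowering κ(S,T), and a third way c(v). Each `v` then also lies in a step of the
lattice of tight sets: X and X ∪ {v} are both tight.

As Q ∪ R never meets the region between the least and greatest tight sets for (Q,R), only the at
most 2ℓ vertices of S ∪ T interrupt F there, so some tight X ⊆ Y have Y \ X ⊆ F of size at least
2^(2k) (`exists_interval`). Now ρ(Y \ X) ≤ 2k, so a pigeonhole argument (`exists_small_weight`)
gives a nonzero `u` supported in Y \ X with type c(v) at all but at most two vertices of its support
D. But `u` has type a at a lowest and at a highest vertex of D for (Q,R), and type b at a lowest
vertex for (S,T): three distinct exceptions. -/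

namespace SimpleGraph

open Module

/-! ### Adjacency over GF(2). -/

section AdjBit

variable {V : Type*}

open Classical in
/-- The entries of the adjacency matrix over `GF(2)`. -/
noncomputable def adjBit (G : SimpleGraph V) (x y : V) : ZMod 2 := if G.Adj x y then 1 else 0

lemma adjBit_comm (G : SimpleGraph V) (x y : V) : G.adjBit x y = G.adjBit y x := by
  by_cases h : G.Adj x y
  · simp [adjBit, h, h.symm]
  · simpa [adjBit, h] using fun h' : G.Adj y x => h h'.symm

@[simp] lemma adjBit_self (G : SimpleGraph V) (x : V) : G.adjBit x x = 0 := by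
  simp [adjBit]

lemma adjBit_deleteVertex (G : SimpleGraph V) (v : V) (x y : {w : V // w ≠ v}) :
    (G.deleteVertex v).adjBit x y = G.adjBit x y := rfl

/-- The last term cancels the square that the product puts on the diagonal. -/
lemma adjBit_localComplement (G : SimpleGraph V) (p x y : V) [DecidableEq V] :
    (G.localComplement p).adjBit x y =
      G.adjBit x y + G.adjBit p x * G.adjBit p y + if x = y then G.adjBit p x else 0 := by
  by_cases hxy : x = y
  · subst hxy
    by_cases h : G.Adj p x <;> simp [adjBit, h]
    decide
  · by_cases h1 : G.Adj x y <;> by_cases h2 : G.Adj p x <;> by_cases h3 : G.Adj p y <;>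
      simp [adjBit, localComplement, hxy, h1, h2, h3, Xor]
    decide

end AdjBit

/-! ### Cut-rank as the codimension of a space of vectors. -/

section CutSpace

variable {V : Type*} [Fintype V]

open Classical in
/-- Multiplication by the adjacency matrix over `GF(2)`. -/
noncomputable def nbrSum (G : SimpleGraph V) : (V → ZMod 2) →ₗ[ZMod 2] (V → ZMod 2) :=
  (G.adjMatrix (ZMod 2)).mulVecLin

lemma nbrSum_apply (G : SimpleGraph V) (u : V → ZMod 2) (w : V) :
    G.nbrSum u w = ∑ x, G.adjBit w x * u x := by
  simp [nbrSum, Matrix.mulVec, dotProduct, adjMatrix_apply, adjBit]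

/-- The vectors `u` such that both `u` and its image under the adjacency matrix vanish
outside `X`. -/
def cutSpace (G : SimpleGraph V) (X : Set V) : Submodule (ZMod 2) (V → ZMod 2) where
  carrier := {u | ∀ w ∉ X, u w = 0 ∧ G.nbrSum u w = 0}
  add_mem' := fun ha hb w hw => by
    simp [(ha w hw).1, (ha w hw).2, (hb w hw).1, (hb w hw).2]
  zero_mem' := fun w _ => by simp
  smul_mem' := fun c x hx w hw => by
    simp [(hx w hw).1, (hx w hw).2]

lemma mem_cutSpace {G : SimpleGraph V} {X : Set V} {u : V → ZMod 2} :
    u ∈ G.cutSpace X ↔ ∀ w ∉ X, u w = 0 ∧ G.nbrSum u w = 0 := Iff.rfl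

lemma cutSpace_mono (G : SimpleGraph V) {X Y : Set V} (h : X ⊆ Y) :
    G.cutSpace X ≤ G.cutSpace Y := fun _ hu w hw => hu w (fun hx => hw (h hx))

lemma cutSpace_inter (G : SimpleGraph V) (X Y : Set V) :
    G.cutSpace (X ∩ Y) = G.cutSpace X ⊓ G.cutSpace Y := by
  ext u
  simp only [Submodule.mem_inf, mem_cutSpace, Set.mem_inter_iff, not_and_or]
  exact ⟨fun h => ⟨fun w hw => h w (Or.inl hw), fun w hw => h w (Or.inr hw)⟩,
    fun h w hw => hw.elim (h.1 w) (h.2 w)⟩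

lemma sum_eq_sum_subtype_of_forall_notMem {M : Type*} [AddCommMonoid M] (p : V → Prop)
    [Fintype {x // p x}] (f : V → M) (hf : ∀ x, ¬ p x → f x = 0) :
    ∑ x, f x = ∑ x : {x // p x}, f x := by
  classical
  rw [← Finset.sum_subtype (Finset.univ.filter p) (by simp) f, Finset.sum_filter]
  refine Finset.sum_congr rfl fun x _ => ?_
  split_ifs with h
  · rfl
  · exact hf x h

open Classical in
lemma cutRank_add_finrank_cutSpace (G : SimpleGraph V) (X : Set V) :
    G.cutRank X + finrank (ZMod 2) (G.cutSpace X) = X.ncard := by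
  set A : Matrix {x : V // x ∈ X} {x : V // x ∉ X} (ZMod 2) :=
    (G.adjMatrix (ZMod 2)).submatrix Subtype.val Subtype.val with hA
  have hr : G.cutRank X = finrank (ZMod 2) (LinearMap.range A.transpose.mulVecLin) := by
    have h1 : A.transpose.rank = A.rank := Matrix.rank_transpose A
    rw [Matrix.rank] at h1
    rw [h1]
    unfold cutRank
    rw [hA]
    congr!
  have key (u : V → ZMod 2) (hu : ∀ x ∉ X, u x = 0) (w : {x : V // x ∉ X}) :
      A.transpose.mulVecLin (fun x : {x : V // x ∈ X} => u x) w = G.nbrSum u w := by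
    rw [nbrSum_apply, sum_eq_sum_subtype_of_forall_notMem (· ∈ X)
      (fun x => G.adjBit w x * u x) (fun x hx => by simp [hu x hx])]
    simp [hA, Matrix.mulVec, dotProduct, adjMatrix_apply, adjBit]
  let e : G.cutSpace X ≃ₗ[ZMod 2] LinearMap.ker A.transpose.mulVecLin :=
    { toFun := fun u => ⟨fun x => u.1 x, by
        rw [LinearMap.mem_ker]
        funext w
        rw [key u.1 (fun x hx => (u.2 x hx).1) w]
        exact (u.2 w w.2).2⟩
      map_add' := fun _ _ => rfl
      map_smul' := fun _ _ => rfl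
      invFun := fun f => ⟨fun x => if hx : x ∈ X then f.1 ⟨x, hx⟩ else 0, fun w hw => by
        refine ⟨by simp [hw], ?_⟩
        rw [← key (fun x => if hx : x ∈ X then f.1 ⟨x, hx⟩ else 0) (fun x hx => by simp [hx])
          ⟨w, hw⟩]
        have : (fun x : {x : V // x ∈ X} =>
            (fun x => if hx : x ∈ X then f.1 ⟨x, hx⟩ else 0) (x : V)) = f.1 := by
          funext x
          simp [x.2]
        rw [this, LinearMap.mem_ker.1 f.2]
        rfl⟩
      left_inv := fun u => by
        ext x
        by_cases hx : x ∈ X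
        · simp [hx]
        · simp [hx, (u.2 x hx).1]
      right_inv := fun f => by
        ext x
        simp [x.2] }
  rw [hr, e.finrank_eq, LinearMap.finrank_range_add_finrank_ker, finrank_fintype_fun_eq_card,
    Set.ncard_eq_toFinset_card', Set.toFinset_card]

open Classical in
lemma cutRank_compl (G : SimpleGraph V) (X : Set V) : G.cutRank Xᶜ = G.cutRank X := by
  set A : Matrix {x : V // x ∈ X} {x : V // x ∉ X} (ZMod 2) :=
    (G.adjMatrix (ZMod 2)).submatrix Subtype.val Subtype.val with hA
  have h1 : G.cutRank X = A.rank := by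
    unfold cutRank
    rw [hA]
    congr!
  rw [h1, ← Matrix.rank_transpose A]
  let e : {x : V // x ∉ Xᶜ} ≃ {x : V // x ∈ X} := Equiv.subtypeEquivRight (by simp)
  have h2 : G.cutRank Xᶜ = (A.transpose.submatrix (Equiv.refl {x : V // x ∉ X}) e).rank := by
    unfold cutRank
    have : A.transpose.submatrix (Equiv.refl {x : V // x ∉ X}) e =
      (G.adjMatrix (ZMod 2)).submatrix (Subtype.val : {x : V // x ∈ Xᶜ} → V)
        (Subtype.val : {x : V // x ∉ Xᶜ} → V) := by
      ext x y
      simp only [hA, Matrix.submatrix_apply, Matrix.transpose_apply, adjMatrix_apply]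
      rw [G.adj_comm]
      rfl
    rw [this]
    congr!
  rw [h2]
  exact Matrix.rank_submatrix _ _ _

/-- Cut spaces intersect to the cut space of X ∩ Y, while their sum only lies inside that of X ∪ Y;
the dimension formula does the rest. -/
lemma cutRank_inter_add_cutRank_union_le (G : SimpleGraph V) (X Y : Set V) :
    G.cutRank (X ∩ Y) + G.cutRank (X ∪ Y) ≤ G.cutRank X + G.cutRank Y := by
  have h1 := Submodule.finrank_sup_add_finrank_inf_eq (G.cutSpace X) (G.cutSpace Y)
  have h2 : finrank (ZMod 2) ↥(G.cutSpace X ⊔ G.cutSpace Y) ≤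
      finrank (ZMod 2) (G.cutSpace (X ∪ Y)) :=
    Submodule.finrank_mono (sup_le (G.cutSpace_mono Set.subset_union_left)
      (G.cutSpace_mono Set.subset_union_right))
  rw [← cutSpace_inter] at h1
  have h3 := Set.ncard_union_add_ncard_inter X Y
  have a := G.cutRank_add_finrank_cutSpace X
  have b := G.cutRank_add_finrank_cutSpace Y
  have c := G.cutRank_add_finrank_cutSpace (X ∩ Y)
  have d := G.cutRank_add_finrank_cutSpace (X ∪ Y)
  omega

/-- The symplectic form vanishes on pairs `(u, N u)`, as the adjacency matrix is symmetric. -/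
lemma sum_mul_nbrSum_comm (G : SimpleGraph V) (u y : V → ZMod 2) :
    ∑ w, u w * G.nbrSum y w = ∑ w, y w * G.nbrSum u w := by
  simp_rw [nbrSum_apply, Finset.mul_sum]
  rw [Finset.sum_comm]
  refine Finset.sum_congr rfl fun x _ => Finset.sum_congr rfl fun w _ => ?_
  rw [G.adjBit_comm]
  ring

end CutSpace

/-! ### Vertex removals as linear conditions at one vertex. -/

section Removal

variable {V : Type*} [Fintype V]

/-- The three ways of removing a vertex. -/
inductive Removal
  | delete
  | complement
  | pivot

instance : Inhabited Removal := ⟨.delete⟩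

/-- The functional at `v` whose kernel is retained when `v` is removed in the given way. -/
noncomputable def removalCoord (G : SimpleGraph V) (v : V) :
    Removal → ((V → ZMod 2) →ₗ[ZMod 2] ZMod 2)
  | .delete => LinearMap.proj v
  | .complement => LinearMap.proj v + LinearMap.proj v ∘ₗ G.nbrSum
  | .pivot => LinearMap.proj v ∘ₗ G.nbrSum

/-- The analogue of `cutSpace` for the graph obtained by removing `v`. -/
noncomputable def removalSpace (G : SimpleGraph V) (v : V) (t : Removal) (X : Set V) :
    Submodule (ZMod 2) (V → ZMod 2) :=
  G.cutSpace (insert v X) ⊓ LinearMap.ker (G.removalCoord v t)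

lemma nbrSum_deleteVertex (G : SimpleGraph V) (v : V) [Fintype {w : V // w ≠ v}]
    (u : V → ZMod 2) (hu : u v = 0) (w : {w : V // w ≠ v}) :
    (G.deleteVertex v).nbrSum (fun x => u x) w = G.nbrSum u w := by
  rw [nbrSum_apply, nbrSum_apply, sum_eq_sum_subtype_of_forall_notMem (· ≠ v)
      (fun x => G.adjBit w x * u x) (fun x hx => by simp [not_not.1 hx, hu])]
  simp [adjBit_deleteVertex]

open Classical in
lemma finrank_cutSpace_deleteVertex (G : SimpleGraph V) (v : V) (Y : Set {w : V // w ≠ v}) :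
    finrank (ZMod 2) ((G.deleteVertex v).cutSpace Y) =
      finrank (ZMod 2) (G.removalSpace v .delete (Subtype.val '' Y)) := by
  have hext (f : {w : V // w ≠ v} → ZMod 2) :
      (fun x : {w : V // w ≠ v} => (fun x => if hx : x ≠ v then f ⟨x, hx⟩ else 0) (x : V)) = f := by
    funext x
    simp [x.2]
  let e : G.removalSpace v .delete (Subtype.val '' Y) ≃ₗ[ZMod 2] (G.deleteVertex v).cutSpace Y :=
    { toFun := fun u => ⟨fun x => u.1 x, fun w hw => by
        have hw' : (w : V) ∉ insert v (Subtype.val '' Y) := by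
          rintro (h | ⟨y, hy, h⟩)
          · exact w.2 h
          · exact hw (Subtype.ext h ▸ hy)
        rw [nbrSum_deleteVertex G v u.1 u.2.2]
        exact u.2.1 w hw'⟩
      map_add' := fun _ _ => rfl
      map_smul' := fun _ _ => rfl
      invFun := fun f => ⟨fun x => if hx : x ≠ v then f.1 ⟨x, hx⟩ else 0, by
        refine ⟨fun w hw => ?_, ?_⟩
        · have hwv : w ≠ v := fun h => hw (Or.inl h)
          have hwY : (⟨w, hwv⟩ : {w : V // w ≠ v}) ∉ Y := fun h => hw (Or.inr ⟨_, h, rfl⟩)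
          have h := f.2 ⟨w, hwv⟩ hwY
          rw [← nbrSum_deleteVertex G v _ (by simp) ⟨w, hwv⟩, hext]
          simpa [hwv] using h
        · simp [removalCoord]⟩
      left_inv := fun u => by
        ext x
        by_cases hx : x = v
        · have := u.2.2
          simp only [removalCoord, SetLike.mem_coe, LinearMap.mem_ker, LinearMap.proj_apply] at this
          simp [hx, this]
        · simp [hx]
      right_inv := fun f => by
        ext x
        simp [x.2] }
  exact e.finrank_eq.symm

open Classical in
/-- The linear map taking the vectors of `G` to those of the local complementation at `p`. -/
noncomputable def localMap (G : SimpleGraph V) (p : V) :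
    (V → ZMod 2) →ₗ[ZMod 2] (V → ZMod 2) :=
  LinearMap.id + (LinearMap.single (ZMod 2) (fun _ => ZMod 2) p) ∘ₗ LinearMap.proj p ∘ₗ G.nbrSum

open Classical in
lemma localMap_apply (G : SimpleGraph V) (p : V) (u : V → ZMod 2) (w : V) :
    G.localMap p u w = u w + if w = p then G.nbrSum u p else 0 := by
  simp [localMap, Pi.single_apply]

lemma nbrSum_localMap (G : SimpleGraph V) (p : V) (u : V → ZMod 2) (w : V) :
    (G.localComplement p).nbrSum (G.localMap p u) w = G.nbrSum u w + G.adjBit p w * u w := by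
  classical
  have h2 : ∀ a : ZMod 2, a + a = 0 := CharTwo.add_self_eq_zero
  rw [nbrSum_apply]
  have h : ∀ x, (G.localComplement p).adjBit w x * G.localMap p u x =
      G.adjBit w x * u x + G.adjBit p w * (G.adjBit p x * u x) +
      (if w = x then G.adjBit p w * u x else 0) +
      (if x = p then G.adjBit p w * G.nbrSum u p else 0) := by
    intro x
    rw [adjBit_localComplement, localMap_apply]
    by_cases hx : x = p
    · subst hx
      by_cases hw : w = x
      · subst hw; simp
      · simp [hw, G.adjBit_comm w x]; ring
    · by_cases hw : w = x
      · subst hw; simp [hx]; ring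
      · simp [hx, hw]; ring
  simp only [h, Finset.sum_add_distrib, ← Finset.mul_sum, ← nbrSum_apply, Finset.sum_ite_eq,
    Finset.sum_ite_eq', Finset.mem_univ, if_true]
  linear_combination h2 (G.adjBit p w * G.nbrSum u p)

lemma localMap_involutive (G : SimpleGraph V) (p : V) : Function.Involutive (G.localMap p) := by
  classical
  intro u
  have h1 : G.nbrSum (G.localMap p u) p = G.nbrSum u p := by
    rw [nbrSum_apply, nbrSum_apply]
    refine Finset.sum_congr rfl fun x _ => ?_
    rw [localMap_apply]
    by_cases hx : x = p
    · subst hx; simp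
    · simp [hx]
  funext w
  rw [localMap_apply, h1, localMap_apply, add_assoc, CharTwo.add_self_eq_zero, add_zero]

/-- `localMap` as a linear equivalence. -/
noncomputable def localEquiv (G : SimpleGraph V) (p : V) :
    (V → ZMod 2) ≃ₗ[ZMod 2] (V → ZMod 2) :=
  LinearEquiv.ofInvolutive (G.localMap p) (G.localMap_involutive p)

/-- `localMap` acts on the pair at each vertex by an invertible 2×2 matrix, so the set of vertices
with nonzero pair is unchanged. -/
lemma mem_cutSpace_localComplement (G : SimpleGraph V) (p : V) (X : Set V) (u : V → ZMod 2) :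
    G.localMap p u ∈ (G.localComplement p).cutSpace X ↔ u ∈ G.cutSpace X := by
  simp only [mem_cutSpace, nbrSum_localMap, localMap_apply]
  refine forall_congr' fun w => imp_congr_right fun _ => ?_
  by_cases hw : w = p
  · subst hw
    simp only [if_true, adjBit_self, zero_mul, add_zero]
    constructor <;> rintro ⟨h1, h2⟩ <;> simp_all
  · simp only [hw, if_false, add_zero]
    constructor <;> rintro ⟨h1, h2⟩ <;> simp_all

lemma finrank_eq_of_mem_iff {K M : Type*} [Field K] [AddCommGroup M] [Module K M]
    {A B : Submodule K M} (e : M ≃ₗ[K] M) (h : ∀ u, e u ∈ B ↔ u ∈ A) :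
    finrank K B = finrank K A := by
  have : A = B.comap (e : M →ₗ[K] M) := by
    ext u
    simp [h]
  rw [this, Submodule.comap_equiv_eq_map_symm, LinearEquiv.finrank_map_eq]

lemma finrank_removalSpace_localComplement (G : SimpleGraph V) (v : V) (X : Set V) :
    finrank (ZMod 2) ((G.localComplement v).removalSpace v .delete X) =
      finrank (ZMod 2) (G.removalSpace v .complement X) := by
  refine finrank_eq_of_mem_iff (G.localEquiv v) fun u => ?_
  change G.localMap v u ∈ _ ↔ _
  simp [removalSpace, mem_cutSpace_localComplement, removalCoord, localMap_apply]

/-- Following the first entry of the pair at `v` through the three complementations turns `y v` into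
`G.nbrSum y v`. The choice of neighbour disappears, which is why one condition covers all of them.
-/
lemma finrank_removalSpace_pivot (G : SimpleGraph V) (u v : V) (huv : G.Adj v u) (X : Set V) :
    finrank (ZMod 2) ((G.pivot u v).removalSpace v .delete X) =
      finrank (ZMod 2) (G.removalSpace v .pivot X) := by
  refine finrank_eq_of_mem_iff ((G.localEquiv u).trans (((G.localComplement u).localEquiv v).trans
    (((G.localComplement u).localComplement v).localEquiv u))) fun y => ?_
  change ((G.localComplement u).localComplement v).localMap u ((G.localComplement u).localMap v
    (G.localMap u y)) ∈ _ ↔ _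
  have hne : v ≠ u := huv.ne
  have hbit : G.adjBit u v = 1 := by simp [adjBit, huv.symm]
  simp only [removalSpace, pivot, Submodule.mem_inf, mem_cutSpace_localComplement, removalCoord,
    LinearMap.mem_ker, LinearMap.proj_apply, localMap_apply, LinearMap.comp_apply, hne, if_false,
    nbrSum_localMap, if_true, hbit]
  have : y v + 0 + (G.nbrSum y v + 1 * y v) + 0 = G.nbrSum y v := by
    linear_combination CharTwo.add_self_eq_zero (y v)
  rw [this]

end Removal
end SimpleGraph

namespace SimpleGraph

open Module

/-! ### Steps and intervals in lattices of sets. -/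

section SetFamilies

variable {V : Type*} [Finite V]

/-- Take a minimal step: if it contained some w of D, intersecting it with a step at w would give a
smaller one. -/
lemma exists_step_disjoint (L : Set (Set V)) (hinf : ∀ X ∈ L, ∀ Y ∈ L, X ∩ Y ∈ L) (D : Set V)
    (hD : D.Nonempty) (hstep : ∀ v ∈ D, ∃ X ∈ L, v ∉ X ∧ insert v X ∈ L) :
    ∃ v ∈ D, ∃ X ∈ L, v ∉ X ∧ insert v X ∈ L ∧ Disjoint X D := by
  obtain ⟨v₀, hv₀⟩ := hD
  obtain ⟨X₀, hX₀, h1, h2⟩ := hstep v₀ hv₀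
  obtain ⟨X, ⟨hX, v, hv, hvX, hins⟩, hmin⟩ :=
    (Set.toFinite {X | X ∈ L ∧ ∃ v ∈ D, v ∉ X ∧ insert v X ∈ L}).exists_minimal
      ⟨X₀, hX₀, v₀, hv₀, h1, h2⟩
  refine ⟨v, hv, X, hX, hvX, hins, Set.disjoint_left.2 fun w hwX hwD => ?_⟩
  obtain ⟨Y, hY, hwY, hYins⟩ := hstep w hwD
  have hmem : X ∩ Y ∈ {X | X ∈ L ∧ ∃ v ∈ D, v ∉ X ∧ insert v X ∈ L} := by
    refine ⟨hinf X hX Y hY, w, hwD, fun h => hwY h.2, ?_⟩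
    have : insert w (X ∩ Y) = X ∩ insert w Y := by
      rw [Set.insert_inter_distrib, Set.insert_eq_of_mem hwX]
    rw [this]
    exact hinf X hX _ hYins
  exact hwY (hmin hmem Set.inter_subset_left hwX).2

/-- Dual argument with a maximal step. Requiring it to contain `B` keeps the new vertex away from
one found earlier. -/
lemma exists_step_superset (L : Set (Set V)) (hsup : ∀ X ∈ L, ∀ Y ∈ L, X ∪ Y ∈ L) (D B : Set V)
    (hB : B ∈ L) (hD : ∃ w ∈ D, w ∉ B) (hstep : ∀ v ∈ D, ∃ X ∈ L, v ∉ X ∧ insert v X ∈ L) :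
    ∃ v ∈ D, v ∉ B ∧ ∃ X ∈ L, v ∉ X ∧ insert v X ∈ L ∧ D ⊆ insert v X := by
  have aux (y : V) (hy : y ∈ D) (C : Set V) (hC : C ∈ L) (hyC : y ∉ C) :
      ∃ X ∈ L, C ⊆ X ∧ y ∉ X ∧ insert y X ∈ L := by
    obtain ⟨Y, hY, hyY, hYins⟩ := hstep y hy
    refine ⟨Y ∪ C, hsup Y hY C hC, Set.subset_union_right, by simp [hyY, hyC], ?_⟩
    rw [← Set.insert_union]
    exact hsup _ hYins C hC
  obtain ⟨v₀, hv₀, hv₀B⟩ := hD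
  obtain ⟨X₀, hX₀, h0, h1, h2⟩ := aux v₀ hv₀ B hB hv₀B
  obtain ⟨X, ⟨hX, hBX, v, hv, hvX, hins⟩, hmax⟩ :=
    (Set.toFinite {X | X ∈ L ∧ B ⊆ X ∧ ∃ v ∈ D, v ∉ X ∧ insert v X ∈ L}).exists_maximal
      ⟨X₀, hX₀, h0, v₀, hv₀, h1, h2⟩
  refine ⟨v, hv, fun h => hvX (hBX h), X, hX, hvX, hins, fun y hy => ?_⟩
  by_contra hyX
  obtain ⟨Y, hY, hXY, hyY, hYins⟩ := aux y hy _ hins hyX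
  have hXY' : X ⊆ Y := (Set.subset_insert _ _).trans hXY
  exact hvX (hmax ⟨hY, hBX.trans hXY', y, hy, hyY, hYins⟩ hXY' (hXY (Set.mem_insert _ _)))

/-- Climb from `P₀` inside `F` as far as possible. If this yields fewer than `N` vertices, the next
larger member adds only vertices outside `F`, so `m` drops at a cost of fewer than `N` vertices of
`F`. -/
lemma exists_interval (L : Set (Set V)) (hinf : ∀ X ∈ L, ∀ Y ∈ L, X ∩ Y ∈ L)
    (hsup : ∀ X ∈ L, ∀ Y ∈ L, X ∪ Y ∈ L) (F : Set V)
    (hstep : ∀ v ∈ F, ∃ X ∈ L, v ∉ X ∧ insert v X ∈ L) (N m : ℕ) (P₁ : Set V) (hP₁ : P₁ ∈ L)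
    (P₀ : Set V) (hP₀ : P₀ ∈ L) (hP : P₀ ⊆ P₁) (hm : ((P₁ \ P₀) \ F).ncard ≤ m)
    (hN : (m + 1) * N ≤ ((P₁ \ P₀) ∩ F).ncard) :
    ∃ X ∈ L, ∃ Y ∈ L, X ⊆ Y ∧ Y \ X ⊆ F ∧ N ≤ (Y \ X).ncard := by
  induction m generalizing P₀ with
  | zero =>
    have h0 : (P₁ \ P₀) \ F = ∅ := (Set.ncard_eq_zero).1 (Nat.le_zero.1 hm)
    have hF : P₁ \ P₀ ⊆ F := Set.sdiff_eq_empty.1 h0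
    refine ⟨P₀, hP₀, P₁, hP₁, hP, hF, ?_⟩
    rw [Set.inter_eq_left.2 hF] at hN
    omega
  | succ m ih =>
    obtain ⟨X, ⟨hX, hPX, hXP, hXF⟩, hmax⟩ :=
      (Set.toFinite {X | X ∈ L ∧ P₀ ⊆ X ∧ X ⊆ P₁ ∧ X \ P₀ ⊆ F}).exists_maximal
        ⟨P₀, hP₀, subset_rfl, hP, by simp⟩
    by_cases hcard : N ≤ (X \ P₀).ncard
    · exact ⟨P₀, hP₀, X, hX, hPX, hXF, hcard⟩
    by_cases hXP₁ : X = P₁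
    · subst hXP₁
      rw [Set.inter_eq_left.2 hXF] at hN
      have : N ≤ (m + 1 + 1) * N := Nat.le_mul_of_pos_left N (Nat.succ_pos _)
      omega
    obtain ⟨P, ⟨hPL, hXsP, hPP₁⟩, hmin⟩ :=
      (Set.toFinite {P | P ∈ L ∧ X ⊂ P ∧ P ⊆ P₁}).exists_minimal
        ⟨P₁, hP₁, hXP.ssubset_of_ne hXP₁, subset_rfl⟩
    -- A step at such a `v`, cut down to `P` and joined with `X`, would make `insert v X` a member,
    -- against the maximality of `X`.
    have hPF : ∀ v ∈ P, v ∉ X → v ∉ F := by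
      intro v hvP hvX hvF
      obtain ⟨Z, hZ, hvZ, hZins⟩ := hstep v hvF
      have hY : X ∪ (Z ∩ P) ∈ L := hsup X hX _ (hinf Z hZ P hPL)
      have hYP : X ∪ (Z ∩ P) ⊆ P := Set.union_subset hXsP.1 Set.inter_subset_right
      have hYX : X ∪ (Z ∩ P) = X := by
        by_contra hne
        have h := hmin ⟨hY, Set.subset_union_left.ssubset_of_ne (Ne.symm hne), hYP.trans hPP₁⟩
          hYP hvP
        exact h.elim hvX fun h => hvZ h.1
      have hvX' : insert v X ∈ L := by
        have : insert v X = X ∪ (insert v Z ∩ P) := by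
          rw [← Set.insert_eq_of_mem hvP, ← Set.insert_inter_distrib, Set.union_insert, hYX]
        rw [this]
        exact hsup X hX _ (hinf _ hZins P hPL)
      have h := hmax ⟨hvX', hPX.trans (Set.subset_insert _ _),
        Set.insert_subset (hPP₁ hvP) hXP, ?_⟩ (Set.subset_insert _ _) (Set.mem_insert v X)
      · exact hvX h
      · rintro w ⟨hw | hw, hw'⟩
        · exact hw ▸ hvF
        · exact hXF ⟨hw, hw'⟩
    obtain ⟨w, hwP, hwX⟩ := Set.exists_of_ssubset hXsP
    refine ih P hPL hPP₁ ?_ ?_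
    · have hss : (P₁ \ P) \ F ⊂ (P₁ \ P₀) \ F := by
        refine Set.ssubset_iff_exists.2 ⟨fun x hx => ⟨⟨hx.1.1, fun h => hx.1.2 (hXsP.1 (hPX h))⟩,
          hx.2⟩, w, ⟨⟨hPP₁ hwP, fun h => hwX (hPX h)⟩, hPF w hwP hwX⟩, fun h => h.1.2 hwP⟩
      have := Set.ncard_lt_ncard hss
      omega
    · have hsub : (P₁ \ P₀) ∩ F ⊆ (X \ P₀) ∪ ((P₁ \ P) ∩ F) := by
        rintro x ⟨⟨hx1, hx0⟩, hxF⟩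
        by_cases hxX : x ∈ X
        · exact Or.inl ⟨hxX, hx0⟩
        · exact Or.inr ⟨⟨hx1, fun h => hPF x h hxX hxF⟩, hxF⟩
      have h1 := Set.ncard_le_ncard hsub
      have h2 := Set.ncard_union_le (X \ P₀) ((P₁ \ P) ∩ F)
      have h3 : (m + 1 + 1) * N = (m + 1) * N + N := by ring
      omega

end SetFamilies

/-- A binary code of length at least `2 ^ r` and codimension at most `r` has a nonzero word
with at most two nonzero coordinates. -/
lemma exists_small_weight {V M : Type*} [Finite V] [AddCommGroup M] [Module (ZMod 2) M]
    (U : Submodule (ZMod 2) M) [FiniteDimensional (ZMod 2) U] (F : Set V) (r : ℕ)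
    (hU : F.ncard ≤ finrank (ZMod 2) U + r) (hF : 2 ^ r ≤ F.ncard)
    (f : V → (M →ₗ[ZMod 2] ZMod 2)) :
    ∃ u ∈ U, u ≠ 0 ∧ ∃ p q, ∀ v ∈ F, f v u ≠ 0 → v = p ∨ v = q := by
  classical
  have := Fintype.ofFinite V
  have hpos : 0 < F.ncard := lt_of_lt_of_le (by positivity) hF
  obtain ⟨v₀, -⟩ := (Set.ncard_pos (Set.toFinite F)).1 hpos
  let g : U →ₗ[ZMod 2] (F → ZMod 2) := LinearMap.pi fun v => f v ∘ₗ U.subtype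
  have hg (u : U) (v : F) : g u v = f v u := rfl
  by_cases hinj : Function.Injective g
  swap
  · rw [← LinearMap.ker_eq_bot, Submodule.eq_bot_iff] at hinj
    push Not at hinj
    obtain ⟨u, hu, hu0⟩ := hinj
    refine ⟨u, u.2, by simpa using hu0, v₀, v₀, fun v hv h => absurd ?_ h⟩
    rw [← hg u ⟨v, hv⟩, LinearMap.mem_ker.1 hu]
    rfl
  have hcardF : Fintype.card F = F.ncard := by
    rw [Set.ncard_eq_toFinset_card', Set.toFinset_card]
  have hquot := Submodule.finrank_quotient_add_finrank (LinearMap.range g)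
  rw [LinearMap.finrank_range_of_inj hinj, finrank_fintype_fun_eq_card, hcardF] at hquot
  have : Finite ((F → ZMod 2) ⧸ LinearMap.range g) := Quotient.finite _
  have := Fintype.ofFinite ((F → ZMod 2) ⧸ LinearMap.range g)
  have hcardQ : Fintype.card ((F → ZMod 2) ⧸ LinearMap.range g) ≤ 2 ^ r := by
    rw [Module.card_eq_pow_finrank (K := ZMod 2), ZMod.card]
    exact Nat.pow_le_pow_right (by norm_num) (by omega)
  -- Zero and the unit vectors number |F| + 1 > 2^r, so two share a coset; their difference is a
  -- word of weight 1 or 2.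
  let h : Option F → (F → ZMod 2) := fun i => i.elim 0 fun j => Pi.single j 1
  have hh (i : Option F) (v : F) : h i v ≠ 0 → i = some v := by
    cases i with
    | none => simp [h]
    | some j =>
      intro hv
      by_contra hne
      exact hv (Pi.single_eq_of_ne (fun e => hne (by rw [e])) _)
  have hself (v : F) : h (some v) v = 1 := by simp [h]
  obtain ⟨i, j, hij, he⟩ := Fintype.exists_ne_map_eq_of_card_lt
    (fun i => Submodule.Quotient.mk (p := LinearMap.range g) (h i)) (by
      rw [Fintype.card_option, hcardF]; omega)
  obtain ⟨u, hu⟩ := (Submodule.Quotient.eq _).1 he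
  refine ⟨u, u.2, ?_, (i.map Subtype.val).getD v₀, (j.map Subtype.val).getD v₀, ?_⟩
  · intro h0
    have h0' : u = 0 := Subtype.ext h0
    rw [h0', map_zero] at hu
    have heq : h i = h j := (sub_eq_zero.1 hu.symm)
    cases i with
    | some a => exact hij (hh j a (by rw [← heq, hself]; exact one_ne_zero)).symm
    | none =>
      cases j with
      | none => exact hij rfl
      | some b => exact hij (hh none b (by rw [heq, hself]; exact one_ne_zero))
  · intro v hv hne
    rw [← hg u ⟨v, hv⟩, hu, Pi.sub_apply] at hne
    by_cases hi : h i ⟨v, hv⟩ = 0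
    · rw [hi, zero_sub, neg_ne_zero] at hne
      right
      rw [hh j _ hne]
      rfl
    · left
      rw [hh i _ hi]
      rfl

/-! ### When a removal lowers connectivity. -/

section Removal

variable {V : Type*} [Fintype V]

lemma eq_zero_of_removalCoord_eq_zero (G : SimpleGraph V) (v : V) {s t : Removal} (hst : s ≠ t)
    {u : V → ZMod 2} (hs : G.removalCoord v s u = 0) (ht : G.removalCoord v t u = 0) :
    u v = 0 ∧ G.nbrSum u v = 0 := by
  cases s <;> cases t <;> simp_all [removalCoord]

lemma removalCoord_eq_zero (G : SimpleGraph V) (v : V) (t : Removal)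
    {u : V → ZMod 2} (hu : u v = 0 ∧ G.nbrSum u v = 0) : G.removalCoord v t u = 0 := by
  cases t <;> simp [removalCoord, hu.1, hu.2]

lemma exists_removalCoord_eq_zero (G : SimpleGraph V) (v : V) (u : V → ZMod 2) :
    ∃ t, G.removalCoord v t u = 0 := by
  have key : ∀ a b : ZMod 2, a = 0 ∨ a + b = 0 ∨ b = 0 := by decide
  rcases key (u v) (G.nbrSum u v) with h | h | h
  · exact ⟨.delete, h⟩
  · exact ⟨.complement, h⟩
  · exact ⟨.pivot, h⟩

/-- Two vectors whose coordinates at `v` are symplectically orthogonal, the first of them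
nonzero, have the same type at `v`. -/
lemma removalCoord_eq_zero_of_mul_eq (G : SimpleGraph V) (v : V) (t : Removal)
    {u y : V → ZMod 2} (hu : ¬ (u v = 0 ∧ G.nbrSum u v = 0)) (ht : G.removalCoord v t u = 0)
    (h : u v * G.nbrSum y v = y v * G.nbrSum u v) : G.removalCoord v t y = 0 := by
  have key : ∀ a b c d : ZMod 2, ¬ (a = 0 ∧ b = 0) → a * d = c * b →
      (a = 0 → c = 0) ∧ (a + b = 0 → c + d = 0) ∧ (b = 0 → d = 0) := by decide
  obtain ⟨h1, h2, h3⟩ := key _ _ _ _ hu h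
  cases t
  · exact h1 ht
  · exact h2 ht
  · exact h3 ht

lemma removalSpace_le (G : SimpleGraph V) (v : V) (t : Removal) (X : Set V) :
    G.removalSpace v t X ≤ G.cutSpace (insert v X) := inf_le_left

lemma cutSpace_le_removalSpace (G : SimpleGraph V) (v : V) (t : Removal) {X : Set V}
    (hv : v ∉ X) : G.cutSpace X ≤ G.removalSpace v t X := fun _ hu =>
  ⟨G.cutSpace_mono (Set.subset_insert _ _) hu, G.removalCoord_eq_zero v t (hu v hv)⟩

lemma mem_cutSpace_of_mem_insert {G : SimpleGraph V} {v : V} {X : Set V} {u : V → ZMod 2}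
    (hu : u ∈ G.cutSpace (insert v X)) (h : u v = 0 ∧ G.nbrSum u v = 0) : u ∈ G.cutSpace X := by
  intro w hw
  by_cases hwv : w = v
  · exact hwv ▸ h
  · exact hu w (by simp [hwv, hw])

lemma finrank_le_finrank_inf_ker_add_one {K M : Type*} [Field K] [AddCommGroup M] [Module K M]
    [FiniteDimensional K M] (A : Submodule K M) (f : M →ₗ[K] K) :
    finrank K A ≤ finrank K ↥(A ⊓ LinearMap.ker f) + 1 := by
  have h1 := LinearMap.finrank_range_add_finrank_ker (f ∘ₗ A.subtype)
  have h2 : finrank K (LinearMap.range (f ∘ₗ A.subtype)) ≤ 1 := by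
    simpa using Submodule.finrank_le (LinearMap.range (f ∘ₗ A.subtype))
  have h3 : finrank K (LinearMap.ker (f ∘ₗ A.subtype)) ≤ finrank K ↥(A ⊓ LinearMap.ker f) := by
    rw [← Submodule.finrank_map_subtype_eq, LinearMap.ker_comp, Submodule.map_comap_subtype]
  omega

/-- Imposing a second functional at `v` costs at most one dimension and forces the whole pair there
to vanish. -/
lemma finrank_removalSpace_le (G : SimpleGraph V) (v : V) (t : Removal) (X : Set V) :
    finrank (ZMod 2) (G.removalSpace v t X) ≤ finrank (ZMod 2) (G.cutSpace X) + 1 := by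
  obtain ⟨s, hs⟩ : ∃ s : Removal, s ≠ t := by
    cases t
    exacts [⟨.pivot, by simp⟩, ⟨.pivot, by simp⟩, ⟨.delete, by simp⟩]
  refine (finrank_le_finrank_inf_ker_add_one _ (G.removalCoord v s)).trans
    (Nat.add_le_add_right (Submodule.finrank_mono ?_) 1)
  rintro u ⟨⟨hu, ht⟩, h⟩
  exact mem_cutSpace_of_mem_insert hu (G.eq_zero_of_removalCoord_eq_zero v hs h ht)

/-- Removing `v` in the way `t` lowers the connectivity between `Q` and `R` below `k`. -/
def LowersConnectivity (G : SimpleGraph V) (v : V) (t : Removal) (Q R : Set V) (k : ℕ) : Prop :=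
  ∃ X : Set V, Q ⊆ X ∧ X ⊆ Rᶜ ∧ v ∉ X ∧ X.ncard < k + finrank (ZMod 2) (G.removalSpace v t X)

/-- The sets `X` separating `Q` from `R` with cut-rank `k`. -/
def tightSets (G : SimpleGraph V) (Q R : Set V) (k : ℕ) : Set (Set V) :=
  {X | Q ⊆ X ∧ X ⊆ Rᶜ ∧ G.cutRank X = k}

variable {G : SimpleGraph V} {Q R : Set V} {k : ℕ}

lemma le_cutRank (hk : G.cutConnectivity Q R = k) {X : Set V} (h1 : Q ⊆ X) (h2 : X ⊆ Rᶜ) :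
    k ≤ G.cutRank X := hk ▸ Nat.sInf_le ⟨X, h1, h2, rfl⟩

lemma tightSets_nonempty (hQR : Disjoint Q R) (hk : G.cutConnectivity Q R = k) :
    (G.tightSets Q R k).Nonempty := by
  have hne : {r : ℕ | ∃ X : Set V, Q ⊆ X ∧ X ⊆ Rᶜ ∧ G.cutRank X = r}.Nonempty :=
    ⟨_, Q, subset_rfl, hQR.subset_compl_right, rfl⟩
  obtain ⟨X, h1, h2, h3⟩ := Nat.sInf_mem hne
  exact ⟨X, h1, h2, h3.trans hk⟩

lemma inter_union_mem_tightSets (hk : G.cutConnectivity Q R = k) {X Y : Set V}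
    (hX : X ∈ G.tightSets Q R k) (hY : Y ∈ G.tightSets Q R k) :
    X ∩ Y ∈ G.tightSets Q R k ∧ X ∪ Y ∈ G.tightSets Q R k := by
  obtain ⟨hX1, hX2, hX3⟩ := hX
  obtain ⟨hY1, hY2, hY3⟩ := hY
  have a1 := Set.subset_inter hX1 hY1
  have a2 : X ∩ Y ⊆ Rᶜ := Set.inter_subset_left.trans hX2
  have b1 : Q ⊆ X ∪ Y := hX1.trans Set.subset_union_left
  have b2 := Set.union_subset hX2 hY2
  have := le_cutRank hk a1 a2
  have := le_cutRank hk b1 b2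
  have := G.cutRank_inter_add_cutRank_union_le X Y
  exact ⟨⟨a1, a2, by omega⟩, ⟨b1, b2, by omega⟩⟩

/-- Removal never raises the cut-rank of a tight set: if it contains `v`, one element and at most
one dimension are lost. A value below `k` would be a witness of `LowersConnectivity`. -/
lemma cutConnectivity_eq_of_not_lowersConnectivity {v : V} {t : Removal} (hQR : Disjoint Q R)
    (hk : G.cutConnectivity Q R = k) (hvQ : v ∉ Q)
    (ht : ¬ G.LowersConnectivity v t Q R k) (H : SimpleGraph {w : V // w ≠ v})
    (hH : ∀ Y : Set {w : V // w ≠ v}, H.cutRank Y +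
      finrank (ZMod 2) (G.removalSpace v t (Subtype.val '' Y)) = Y.ncard) :
    H.cutConnectivity (Subtype.val ⁻¹' Q) (Subtype.val ⁻¹' R) = k := by
  have hnc (Y : Set {w : V // w ≠ v}) : (Subtype.val '' Y).ncard = Y.ncard :=
    Set.ncard_image_of_injective Y Subtype.val_injective
  have hvY (Y : Set {w : V // w ≠ v}) : v ∉ Subtype.val '' Y := by
    rintro ⟨y, -, hy⟩
    exact y.2 hy
  apply le_antisymm
  · obtain ⟨X, hX1, hX2, hX3⟩ := tightSets_nonempty hQR hk
    have hle : H.cutConnectivity (Subtype.val ⁻¹' Q) (Subtype.val ⁻¹' R) ≤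
        H.cutRank (Subtype.val ⁻¹' X) :=
      Nat.sInf_le ⟨_, Set.preimage_mono hX1, Set.preimage_mono hX2, rfl⟩
    refine hle.trans ?_
    have h1 := hH (Subtype.val ⁻¹' X)
    have himg : (Subtype.val '' (Subtype.val ⁻¹' X : Set {w : V // w ≠ v})) = X \ {v} := by
      ext x
      simp [and_comm]
    have h2 := hnc (Subtype.val ⁻¹' X)
    rw [himg] at h1 h2
    have h3 := G.cutRank_add_finrank_cutSpace X
    by_cases hv : v ∈ X
    · have h4 := finrank_le_finrank_inf_ker_add_one (G.cutSpace X) (G.removalCoord v t)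
      have h5 : G.removalSpace v t (X \ {v}) = G.cutSpace X ⊓ LinearMap.ker (G.removalCoord v t) := by
        rw [removalSpace, Set.insert_sdiff_singleton, Set.insert_eq_of_mem hv]
      rw [← h5] at h4
      have h6 := Set.ncard_sdiff_singleton_add_one hv
      omega
    · rw [Set.sdiff_singleton_eq_self hv] at h1 h2
      have h4 := Submodule.finrank_mono (G.cutSpace_le_removalSpace v t hv)
      omega
  · have hdisj : Disjoint (Subtype.val ⁻¹' Q : Set {w : V // w ≠ v}) (Subtype.val ⁻¹' R) :=
      hQR.preimage _
    have := Fintype.ofFinite {w : V // w ≠ v}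
    obtain ⟨Y, hY1, hY2, hY3⟩ := tightSets_nonempty hdisj
      (rfl : H.cutConnectivity (Subtype.val ⁻¹' Q) (Subtype.val ⁻¹' R) = _)
    rw [← hY3]
    by_contra hlt
    refine ht ⟨Subtype.val '' Y, fun x hx => ?_, ?_, hvY Y, ?_⟩
    · have hxv : x ≠ v := fun h => hvQ (h ▸ hx)
      exact ⟨⟨x, hxv⟩, hY1 hx, rfl⟩
    · rintro _ ⟨y, hy, rfl⟩
      exact hY2 hy
    · have h1 := hH Y
      have h2 := hnc Y
      omega

/-- For distinct ways, the two removal spaces meet inside `cutSpace (X ∩ Y)` and span a subspace of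
`cutSpace (insert v (X ∪ Y))`. Their dimensions total at least |X| + |Y| - 2k + 2, while those two
cut spaces allow at most |X| + |Y| - 2k + 1. -/
lemma LowersConnectivity.eq {v : V} {s t : Removal} (hk : G.cutConnectivity Q R = k)
    (hvR : v ∉ R) (hs : G.LowersConnectivity v s Q R k) (ht : G.LowersConnectivity v t Q R k) :
    s = t := by
  by_contra hst
  obtain ⟨X, hX1, hX2, hX3, hX4⟩ := hs
  obtain ⟨Y, hY1, hY2, hY3, hY4⟩ := ht
  have h1 := Submodule.finrank_sup_add_finrank_inf_eq (G.removalSpace v s X) (G.removalSpace v t Y)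
  have h2 : G.removalSpace v s X ⊓ G.removalSpace v t Y ≤ G.cutSpace (X ∩ Y) := by
    rintro u ⟨⟨hu1, hu2⟩, hu3, hu4⟩
    have h := G.eq_zero_of_removalCoord_eq_zero v hst hu2 hu4
    rw [cutSpace_inter]
    exact ⟨mem_cutSpace_of_mem_insert hu1 h, mem_cutSpace_of_mem_insert hu3 h⟩
  have h3 : G.removalSpace v s X ⊔ G.removalSpace v t Y ≤ G.cutSpace (insert v (X ∪ Y)) :=
    sup_le ((G.removalSpace_le v s X).trans
        (G.cutSpace_mono (Set.insert_subset_insert Set.subset_union_left)))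
      ((G.removalSpace_le v t Y).trans
        (G.cutSpace_mono (Set.insert_subset_insert Set.subset_union_right)))
  have h4 := Submodule.finrank_mono h2
  have h5 := Submodule.finrank_mono h3
  have h6 := le_cutRank hk (Set.subset_inter hX1 hY1)
    ((Set.inter_subset_left : X ∩ Y ⊆ X).trans hX2)
  have h7 := le_cutRank hk
    ((hX1.trans Set.subset_union_left).trans (Set.subset_insert v (X ∪ Y)))
    (Set.insert_subset hvR (Set.union_subset hX2 hY2))
  have h8 := G.cutRank_add_finrank_cutSpace (X ∩ Y)
  have h9 := G.cutRank_add_finrank_cutSpace (insert v (X ∪ Y))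
  rw [Set.ncard_insert_of_notMem (by simp [hX3, hY3])] at h9
  have h10 := Set.ncard_union_add_ncard_inter X Y
  omega

lemma LowersConnectivity.exists_tight {v : V} {t : Removal} (hk : G.cutConnectivity Q R = k)
    (hvR : v ∉ R) (ht : G.LowersConnectivity v t Q R k) :
    ∃ X ∈ G.tightSets Q R k, v ∉ X ∧ insert v X ∈ G.tightSets Q R k := by
  obtain ⟨X, hX1, hX2, hX3, hX4⟩ := ht
  have a1 := hX1.trans (Set.subset_insert v X)
  have a2 := Set.insert_subset (s := X) (t := Rᶜ) hvR hX2
  have h1 := le_cutRank hk hX1 hX2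
  have h2 := le_cutRank hk a1 a2
  have h3 := G.finrank_removalSpace_le v t X
  have h4 := Submodule.finrank_mono (G.removalSpace_le v t X)
  have h5 := G.cutRank_add_finrank_cutSpace X
  have h6 := G.cutRank_add_finrank_cutSpace (insert v X)
  rw [Set.ncard_insert_of_notMem hX3] at h6
  exact ⟨X, ⟨hX1, hX2, by omega⟩, hX3, a1, a2, by omega⟩

/-- `u` survives the removal and adds a dimension to `cutSpace X`, which already has dimension |X| -
k. -/
lemma lowersConnectivity_of_mem_insert {v : V} {t : Removal} {X : Set V}
    (hX : X ∈ G.tightSets Q R k) (hvX : v ∉ X) {u : V → ZMod 2}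
    (hu : u ∈ G.cutSpace (insert v X)) (huv : ¬ (u v = 0 ∧ G.nbrSum u v = 0))
    (ht : G.removalCoord v t u = 0) : G.LowersConnectivity v t Q R k := by
  refine ⟨X, hX.1, hX.2.1, hvX, ?_⟩
  have hlt : G.cutSpace X < G.removalSpace v t X :=
    (G.cutSpace_le_removalSpace v t hvX).lt_of_ne fun h =>
      huv ((h ▸ (⟨hu, ht⟩ : u ∈ G.removalSpace v t X) : u ∈ G.cutSpace X) v hvX)
  have h1 := Submodule.finrank_lt_finrank_of_lt hlt
  have h2 := G.cutRank_add_finrank_cutSpace X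
  have h3 := hX.2.2
  omega

/-- Since X and X ∪ {v} have equal cut-rank, there is a `y` supported in X ∪ {v} with nonzero pair
at `v`. It meets `u` only at `v`, so symplectic orthogonality forces equal types there. -/
lemma lowersConnectivity_of_mem_compl {v : V} {t : Removal} {X : Set V}
    (hX : X ∈ G.tightSets Q R k) (hvX : v ∉ X) (hX' : insert v X ∈ G.tightSets Q R k)
    {u : V → ZMod 2} (hu : u ∈ G.cutSpace Xᶜ) (huv : ¬ (u v = 0 ∧ G.nbrSum u v = 0))
    (ht : G.removalCoord v t u = 0) : G.LowersConnectivity v t Q R k := by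
  obtain ⟨y, hy, hyX⟩ : ∃ y ∈ G.cutSpace (insert v X), y ∉ G.cutSpace X := by
    by_contra! h
    have h1 := Submodule.finrank_mono (show G.cutSpace (insert v X) ≤ G.cutSpace X from h)
    have h2 := G.cutRank_add_finrank_cutSpace X
    have h3 := G.cutRank_add_finrank_cutSpace (insert v X)
    rw [Set.ncard_insert_of_notMem hvX] at h3
    have h4 := hX.2.2
    have h5 := hX'.2.2
    omega
  have hsum := G.sum_mul_nbrSum_comm u y
  have hzero (w : V) (hw : w ≠ v) : (u w = 0 ∧ G.nbrSum u w = 0) ∨ (y w = 0 ∧ G.nbrSum y w = 0) := by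
    by_cases hwX : w ∈ X
    · exact Or.inl (hu w (by simpa using hwX))
    · exact Or.inr (hy w (by simp [hw, hwX]))
  rw [Finset.sum_eq_single v (fun w _ hw => by rcases hzero w hw with h | h <;> simp [h]) (by simp),
    Finset.sum_eq_single v (fun w _ hw => by rcases hzero w hw with h | h <;> simp [h]) (by simp)]
    at hsum
  exact lowersConnectivity_of_mem_insert hX hvX hy
    (fun h => hyX (mem_cutSpace_of_mem_insert hy h))
    (G.removalCoord_eq_zero_of_mul_eq v t huv ht hsum)

end Removal
end SimpleGraph

namespace SimpleGraph

open Module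

/-! ### Two connectivities at once. -/

section Intertwining

variable {V : Type*} [Fintype V] {G : SimpleGraph V} {Q R S T : Set V} {k l : ℕ}

/-- The outcome of removing `v` in the way `t`: both connectivities are kept. -/
def KeepsConnectivities (G : SimpleGraph V) (v : V) (Q R S T : Set V) (k l : ℕ) : Removal → Prop
  | .delete => (G.deleteVertex v).HasConnectivities Q R S T k l
  | .complement => ((G.localComplement v).deleteVertex v).HasConnectivities Q R S T k l
  | .pivot => ∀ u : V, G.Adj v u → ((G.pivot u v).deleteVertex v).HasConnectivities Q R S T k l

lemma cutRank_deleteVertex_add_finrank (G : SimpleGraph V) (v : V) (Y : Set {w : V // w ≠ v}) :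
    (G.deleteVertex v).cutRank Y +
      finrank (ZMod 2) (G.removalSpace v .delete (Subtype.val '' Y)) = Y.ncard := by
  classical
  rw [← finrank_cutSpace_deleteVertex]
  convert (G.deleteVertex v).cutRank_add_finrank_cutSpace Y

lemma keepsConnectivities {v : V} (t : Removal) (hQR : Disjoint Q R) (hST : Disjoint S T)
    (hk : G.cutConnectivity Q R = k) (hl : G.cutConnectivity S T = l)
    (hv : v ∈ (Q ∪ R ∪ S ∪ T)ᶜ) (h1 : ¬ G.LowersConnectivity v t Q R k)
    (h2 : ¬ G.LowersConnectivity v t S T l) : G.KeepsConnectivities v Q R S T k l t := by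
  simp only [Set.mem_compl_iff, Set.mem_union, not_or] at hv
  obtain ⟨⟨⟨hvQ, -⟩, hvS⟩, -⟩ := hv
  have key (H : SimpleGraph {w : V // w ≠ v}) (hH : ∀ Y : Set {w : V // w ≠ v}, H.cutRank Y +
      finrank (ZMod 2) (G.removalSpace v t (Subtype.val '' Y)) = Y.ncard) :
      H.HasConnectivities Q R S T k l :=
    ⟨cutConnectivity_eq_of_not_lowersConnectivity hQR hk hvQ h1 H hH,
      cutConnectivity_eq_of_not_lowersConnectivity hST hl hvS h2 H hH⟩
  cases t with
  | delete => exact key _ (G.cutRank_deleteVertex_add_finrank v)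
  | complement =>
    refine key _ fun Y => ?_
    rw [← finrank_removalSpace_localComplement]
    exact (G.localComplement v).cutRank_deleteVertex_add_finrank v Y
  | pivot =>
    intro u hu
    refine key _ fun Y => ?_
    rw [← finrank_removalSpace_pivot G u v hu]
    exact (G.pivot u v).cutRank_deleteVertex_add_finrank v Y

/-- If at most one way were bad for `A` or `B` in total, the other two would satisfy `P`. -/
lemma exists_distinct_of_not_atLeastTwo {A B P : Removal → Prop}
    (hA : ∀ s t, A s → A t → s = t) (hB : ∀ s t, B s → B t → s = t)
    (hP : ∀ t, ¬ A t → ¬ B t → P t) (h : ¬ AtLeastTwo (P .delete) (P .complement) (P .pivot)) :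
    ∃ a b c, A a ∧ B b ∧ a ≠ b ∧ c ≠ a ∧ c ≠ b := by
  have key (r : Removal) (hr : ∀ t, t ≠ r → ¬ A t ∧ ¬ B t) : False := by
    have hr' (t : Removal) (ht : t ≠ r) : P t := hP t (hr t ht).1 (hr t ht).2
    cases r with
    | delete => exact h (Or.inr (Or.inr ⟨hr' _ nofun, hr' _ nofun⟩))
    | complement => exact h (Or.inr (Or.inl ⟨hr' _ nofun, hr' _ nofun⟩))
    | pivot => exact h (Or.inl ⟨hr' _ nofun, hr' _ nofun⟩)
  have keyA (a : Removal) (ha : A a) (hab : ∀ b, B b → b = a) : False :=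
    key a fun t ht => ⟨fun h' => ht (hA t a h' ha), fun h' => ht (hab t h')⟩
  have keyB (b : Removal) (hb : B b) (hab : ∀ a, A a → a = b) : False :=
    key b fun t ht => ⟨fun h' => ht (hab t h'), fun h' => ht (hB t b h' hb)⟩
  obtain ⟨a, ha⟩ : ∃ a, A a := by
    by_contra! hno
    by_cases hb : ∃ b, B b
    · obtain ⟨b, hb⟩ := hb
      exact keyB b hb fun a ha => absurd ha (hno a)
    · exact key .delete fun t _ => ⟨hno t, fun h' => hb ⟨t, h'⟩⟩
  obtain ⟨b, hb, hba⟩ : ∃ b, B b ∧ b ≠ a := by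
    by_contra! hno
    exact keyA a ha hno
  have hthird : ∀ a b : Removal, ∃ c, c ≠ a ∧ c ≠ b := by
    intro a b
    by_contra! h
    have h1 := h .delete
    have h2 := h .complement
    have h3 := h .pivot
    cases a <;> cases b <;> simp at h1 h2 h3
  obtain ⟨c, hca, hcb⟩ := hthird a b
  exact ⟨a, b, c, ha, hb, hba.symm, hca, hcb⟩

/-- A long interval between tight sets all of whose elements lie in `F`. -/
lemma exists_tight_interval (hQR : Disjoint Q R) (hk : G.cutConnectivity Q R = k) (hS : S.ncard = l) (hT : T.ncard = l) (N : ℕ)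
    (hF : (2 * l + 1) * N ≤ ((Q ∪ R ∪ S ∪ T)ᶜ).ncard)
    (hstep : ∀ v ∈ (Q ∪ R ∪ S ∪ T)ᶜ,
      ∃ X ∈ G.tightSets Q R k, v ∉ X ∧ insert v X ∈ G.tightSets Q R k) :
    ∃ X ∈ G.tightSets Q R k, ∃ Y ∈ G.tightSets Q R k, X ⊆ Y ∧
      Y \ X ⊆ (Q ∪ R ∪ S ∪ T)ᶜ ∧ N ≤ (Y \ X).ncard := by
  have hinf : ∀ X ∈ G.tightSets Q R k, ∀ Y ∈ G.tightSets Q R k, X ∩ Y ∈ G.tightSets Q R k :=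
    fun X hX Y hY => (inter_union_mem_tightSets hk hX hY).1
  have hsup : ∀ X ∈ G.tightSets Q R k, ∀ Y ∈ G.tightSets Q R k, X ∪ Y ∈ G.tightSets Q R k :=
    fun X hX Y hY => (inter_union_mem_tightSets hk hX hY).2
  obtain ⟨P₀, hP₀, hmin⟩ := (Set.toFinite (G.tightSets Q R k)).exists_minimal
    (tightSets_nonempty hQR hk)
  obtain ⟨P₁, hP₁, hmax⟩ := (Set.toFinite (G.tightSets Q R k)).exists_maximal
    (tightSets_nonempty hQR hk)
  have hlow : ∀ X ∈ G.tightSets Q R k, P₀ ⊆ X := fun X hX =>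
    (hmin (hinf _ hP₀ X hX) Set.inter_subset_left).trans Set.inter_subset_right
  have hupp : ∀ X ∈ G.tightSets Q R k, X ⊆ P₁ := fun X hX =>
    Set.subset_union_right.trans (hmax (hsup _ hP₁ X hX) Set.subset_union_left)
  -- `2 * l` bounds |S ∪ T|: `P₀` contains Q, and `P₁` avoids R. The steps place all of F between
  -- `P₀` and `P₁`.
  refine exists_interval _ hinf hsup _ hstep N (2 * l) P₁ hP₁ P₀ hP₀ (hlow _ hP₁) ?_ ?_
  · have hsub : (P₁ \ P₀) \ (Q ∪ R ∪ S ∪ T)ᶜ ⊆ S ∪ T := by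
      rintro x ⟨⟨hx1, hx0⟩, hx⟩
      rw [Set.mem_compl_iff, not_not] at hx
      rcases hx with ((h | h) | h) | h
      · exact absurd (hP₀.1 h) hx0
      · exact absurd h (hP₁.2.1 hx1)
      · exact Or.inl h
      · exact Or.inr h
    have h1 := Set.ncard_le_ncard hsub
    have h2 := Set.ncard_union_le S T
    omega
  · rwa [Set.inter_eq_right.2]
    intro v hv
    obtain ⟨X, hX, hvX, hX'⟩ := hstep v hv
    exact ⟨hupp _ hX' (Set.mem_insert _ _), fun h => hvX (hlow _ hX h)⟩

/-- Submodularity for X and the complement of Y. -/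
lemma cutRank_diff_le {X Y : Set V} (hX : X ∈ G.tightSets Q R k) (hY : Y ∈ G.tightSets Q R k) :
    G.cutRank (Y \ X) ≤ 2 * k := by
  have h := G.cutRank_inter_add_cutRank_union_le X Yᶜ
  have h1 : X ∪ Yᶜ = (Y \ X)ᶜ := by
    ext x
    simp only [Set.mem_union, Set.mem_compl_iff, Set.mem_sdiff]
    tauto
  rw [h1, cutRank_compl, cutRank_compl, hX.2.2, hY.2.2] at h
  omega

end Intertwining

end SimpleGraph

open SimpleGraph in
theorem mainTheorem3 {V : Type*} [Finite V] (G : SimpleGraph V) (Q R S T : Set V)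
    (hQR : Disjoint Q R) (hST : Disjoint S T) (k l : ℕ)
    (hk : G.cutConnectivity Q R = k) (hl : G.cutConnectivity S T = l)
    (hS : S.ncard = l) (hT : T.ncard = l)
    (hF : (2 * l + 1) * 2 ^ (2 * k) ≤ ((Q ∪ R ∪ S ∪ T)ᶜ).ncard) :
    ∃ v ∈ (Q ∪ R ∪ S ∪ T)ᶜ,
      AtLeastTwo
        ((G.deleteVertex v).HasConnectivities Q R S T k l)
        (((G.localComplement v).deleteVertex v).HasConnectivities Q R S T k l)
        (∀ u : V, G.Adj v u →
          ((G.pivot u v).deleteVertex v).HasConnectivities Q R S T k l) := by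
  have := Fintype.ofFinite V
  by_contra! hcon
  have hnotR : ∀ v ∈ (Q ∪ R ∪ S ∪ T)ᶜ, v ∉ R := fun v hv h => hv (by simp [h])
  have hnotT : ∀ v ∈ (Q ∪ R ∪ S ∪ T)ᶜ, v ∉ T := fun v hv h => hv (by simp [h])
  have hbad : ∀ v ∈ (Q ∪ R ∪ S ∪ T)ᶜ, ∃ a b c, G.LowersConnectivity v a Q R k ∧
      G.LowersConnectivity v b S T l ∧ a ≠ b ∧ c ≠ a ∧ c ≠ b := fun v hv =>
    exists_distinct_of_not_atLeastTwo (P := G.KeepsConnectivities v Q R S T k l)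
      (fun s t hs ht => hs.eq hk (hnotR v hv) ht)
      (fun s t hs ht => hs.eq hl (hnotT v hv) ht)
      (fun t h1 h2 => keepsConnectivities t hQR hST hk hl hv h1 h2) (hcon v hv)
  have hstepQ : ∀ v ∈ (Q ∪ R ∪ S ∪ T)ᶜ,
      ∃ X ∈ G.tightSets Q R k, v ∉ X ∧ insert v X ∈ G.tightSets Q R k := fun v hv => by
    obtain ⟨a, b, c, ha, -⟩ := hbad v hv
    exact ha.exists_tight hk (hnotR v hv)
  have hstepS : ∀ v ∈ (Q ∪ R ∪ S ∪ T)ᶜ,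
      ∃ X ∈ G.tightSets S T l, v ∉ X ∧ insert v X ∈ G.tightSets S T l := fun v hv => by
    obtain ⟨a, b, c, -, hb, -⟩ := hbad v hv
    exact hb.exists_tight hl (hnotT v hv)
  choose! a b c ha hb hab hca hcb using hbad
  obtain ⟨X, hX, Y, hY, -, hYF, hcard⟩ :=
    exists_tight_interval hQR hk hS hT _ hF hstepQ
  have hdim : (Y \ X).ncard ≤ Module.finrank (ZMod 2) (G.cutSpace (Y \ X)) + 2 * k := by
    have h1 := G.cutRank_add_finrank_cutSpace (Y \ X)
    have h2 := cutRank_diff_le hX hY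
    omega
  -- Reading `u` through the functional of type `c v` makes small weight mean: type `c v` on the
  -- support, except at `p` and `q`.
  obtain ⟨u, hu, hu0, p, q, hpq⟩ := exists_small_weight (G.cutSpace (Y \ X)) (Y \ X) (2 * k)
    hdim hcard fun v => G.removalCoord v (c v)
  set D : Set V := {v | ¬ (u v = 0 ∧ G.nbrSum u v = 0)} with hD
  have hDsub : D ⊆ Y \ X := fun v hv => by
    by_contra h
    exact hv (hu v h)
  have hDF : D ⊆ (Q ∪ R ∪ S ∪ T)ᶜ := hDsub.trans hYF
  have huD : ∀ Z : Set V, D ⊆ Z → u ∈ G.cutSpace Z := fun Z hZ w hw => by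
    by_contra h
    exact hw (hZ h)
  have hDne : D.Nonempty := by
    obtain ⟨v, hv⟩ := Function.ne_iff.1 hu0
    exact ⟨v, fun h => hv h.1⟩
  have hDpq : ∀ v ∈ D, ∀ t, t ≠ c v → G.removalCoord v t u = 0 → v = p ∨ v = q :=
    fun v hv t ht h => hpq v (hDsub hv) fun h' =>
      hv (G.eq_zero_of_removalCoord_eq_zero v ht h h')
  have hfirst {A B : Set V} {m : ℕ} {d : V → Removal} (hm : G.cutConnectivity A B = m)
      (hB : ∀ v ∈ D, v ∉ B) (hd : ∀ v ∈ D, G.LowersConnectivity v (d v) A B m)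
      {v : V} (hv : v ∈ D) {Z : Set V} (hZ : Z ∈ G.tightSets A B m) (hvZ : v ∉ Z)
      (hvZ' : insert v Z ∈ G.tightSets A B m) (hZD : Disjoint Z D) :
      G.removalCoord v (d v) u = 0 := by
    obtain ⟨t, ht⟩ := G.exists_removalCoord_eq_zero v u
    have h := lowersConnectivity_of_mem_compl hZ hvZ hvZ'
      (huD _ hZD.subset_compl_left) hv ht
    rwa [(hd v hv).eq hm (hB v hv) h]
  obtain ⟨v, hv, Z, hZ, hvZ, hvZ', hZD⟩ := exists_step_disjoint (G.tightSets Q R k)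
    (fun _ h _ h' => (inter_union_mem_tightSets hk h h').1) D hDne fun w hw => hstepQ w (hDF hw)
  have hva : G.removalCoord v (a v) u = 0 :=
    hfirst hk (fun w hw => hnotR w (hDF hw)) (fun w hw => ha w (hDF hw)) hv hZ hvZ hvZ' hZD
  obtain ⟨x, hx, W, hW, hxW, hxW', hWD⟩ := exists_step_disjoint (G.tightSets S T l)
    (fun _ h _ h' => (inter_union_mem_tightSets hl h h').1) D hDne fun w hw => hstepS w (hDF hw)
  have hxb : G.removalCoord x (b x) u = 0 :=
    hfirst hl (fun w hw => hnotT w (hDF hw)) (fun w hw => hb w (hDF hw)) hx hW hxW hxW' hWD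
  have hne : ∀ w ∈ D, G.removalCoord w (a w) u = 0 → x ≠ w := by
    rintro w hw hwa rfl
    exact hx (G.eq_zero_of_removalCoord_eq_zero x (hab x (hDF hx)) hwa hxb)
  have hxv := hne v hv hva
  have hxZ : x ∉ insert v Z := by
    rintro (h | h)
    · exact hxv h
    · exact Set.disjoint_left.1 hZD h hx
  -- Choosing `B = insert v Z` guarantees `y ≠ v`; the vertex `x` shows that D is not contained in
  -- it.
  obtain ⟨y, hy, hyZ, W', hW', hyW', hyW'', hDW'⟩ := exists_step_superset (G.tightSets Q R k)
    (fun _ h _ h' => (inter_union_mem_tightSets hk h h').2) D (insert v Z) hvZ' ⟨x, hx, hxZ⟩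
    fun w hw => hstepQ w (hDF hw)
  have hya : G.removalCoord y (a y) u = 0 := by
    obtain ⟨t, ht⟩ := G.exists_removalCoord_eq_zero y u
    have h := lowersConnectivity_of_mem_insert hW' hyW' (huD _ hDW') hy ht
    rwa [(ha y (hDF hy)).eq hk (hnotR y (hDF hy)) h]
  have hxy := hne y hy hya
  have hvy : y ≠ v := fun h => hyZ (h ▸ Set.mem_insert _ _)
  have h1 := hDpq v hv _ (hca v (hDF hv)).symm hva
  have h2 := hDpq y hy _ (hca y (hDF hy)).symm hya
  have h3 := hDpq x hx _ (hcb x (hDF hx)).symm hxb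
  -- The distinct vertices `v`, `y`, `x` would all lie in {p, q}.
  grind
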